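/- A partition $\pi=(\lambda_1\ge\lambda_2\ge\cdots)$ (of positive integers, possibly empty) is identified with its Young diagram, whose $i$th row has $\lambda_i$ cells; $|\pi|=\sum_i\lambda_i$, $l(\pi)=\lambda_1$ is the largest part ($0$ if $\pi$ is empty), and $\pi$ is self-conjugate if its diagram is symmetric in the main diagonal. For a positive integer $t$ let $r_j(\pi,t)$, $0\le j\le t-1$, be the number of cells (row $i$, column $m$) of $\pi$ with $m-i\equiv j\pmod t$, and let the GBG-rank of $\pi$ mod $t$ be $$\mathrm{GBG}^{(t)}(\pi)=\sum_{j=0}^{t-1}r_j(\pi,t)\,\omega_t^{\,j},\qquad \omega_t=e^{2\pi\sqrt{-1}/t}.$$ For a non-negative integer $M$ and an integer $k$ let $$GSC_{M,t}(k,q)=\sum_{\substack{\pi\ \text{self-conjugate}\\ \mathrm{GBG}^{(t)}(\pi)=k,\ l(\pi)\le M}}q^{|\pi|}.$$ Write $(a;q)_L=\prod_{j=0}^{L-1}(1-aq^j)$, and let $\left[\begin{matrix}m\\n\end{matrix}\right]_q=\dfrac{(q;q)_m}{(q;q)_n(q;q)_{m-n}}$ if $m\ge n\ge 0$ and $\left[\begin{matrix}m\\n\end{matrix}\right]_q=0$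 otherwise. **Theorem 2.3.** Let $t$ be an odd prime, $N$ a non-negative integer, $\nu\in\{0,1,\ldots,t-1\}$ and $k$ an integer. Then, as formal power series in $q$, $$GSC_{tN+\nu,t}(k,q)=q^{tk^2-(t-1)k}\,(-q^t;q^{2t})_{N+\left\lceil\frac{\nu-(t-1)/2}{t}\right\rceil}\left[\begin{matrix}2N+\lceil\frac{\nu}{t}\rceil\\N+k\end{matrix}\right]_{q^{2t}}\prod_{i=1}^{\frac{t-3}{2}}\left[\begin{matrix}2N+\lceil\frac{\nu-i}{t}\rceil+\lfloor\frac{\nu+i}{t}\rfloor\\N+\lfloor\frac{\nu+i}{t}\rfloor\end{matrix}\right]_{q^{2t}}.$$ -/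

import Mathlib

/-!
Partitions are modelled by their Young diagrams (`YoungDiagram`, which is in bijection with
non-increasing lists of positive integers via `YoungDiagram.equivListRowLens`): the cell in row `i`
and column `j` (counted from `0`) is `(i, j)`, the parts are the row lengths, `|π|` is
`YoungDiagram.card`, the largest part is `YoungDiagram.rowLen π 0` (equal to `0` for the empty
partition) and the conjugate of `π` is `YoungDiagram.transpose π`.
-/

namespace GBGRank

/-- `r_j(π, t)`: the number of cells of the diagram of `π` whose label, the least non-negative
residue of (column - row) modulo `t`, is equal to `j`. -/
def residueCount (π : YoungDiagram) (t j : ℕ) : ℕ :=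
  (π.cells.filter (fun c => ((c.2 : ℤ) - (c.1 : ℤ)) % (t : ℤ) = (j : ℤ))).card

/-- The GBG-rank of `π` mod `t`: `∑_{j=0}^{t-1} r_j(π, t) ω_t ^ j` with `ω_t = exp (2 π i / t)`. -/
noncomputable def gbgRank (π : YoungDiagram) (t : ℕ) : ℂ :=
  ∑ j ∈ Finset.range t,
    (residueCount π t j : ℂ) * Complex.exp (2 * (Real.pi : ℂ) * Complex.I / (t : ℂ)) ^ j

/-- The self-conjugate partitions with largest part at most `M` and GBG-rank mod `t` equal
to `k`. -/
def scPartitions (M t : ℕ) (k : ℤ) : Set YoungDiagram :=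
  {π | π.transpose = π ∧ gbgRank π t = (k : ℂ) ∧ π.rowLen 0 ≤ M}

/-- There are only finitely many such partitions: they fit in an `M × M` square. -/
theorem scPartitions_finite (M t : ℕ) (k : ℤ) : (scPartitions M t k).Finite := by
  have hinj : Function.Injective YoungDiagram.cells := fun a b h => YoungDiagram.ext h
  refine Set.Finite.subset (Set.Finite.preimage hinj.injOn
    (Finset.finite_toSet (Finset.range M ×ˢ Finset.range M).powerset)) ?_
  rintro π ⟨hsc, -, hM⟩
  simp only [Set.mem_preimage, Finset.mem_coe, Finset.mem_powerset]
  rintro ⟨i, j⟩ hc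
  have h1 : (i, j) ∈ π := hc
  have h2 : (j, i) ∈ π := by
    rw [← hsc, YoungDiagram.mem_transpose]
    exact h1
  have key : ∀ a b : ℕ, (a, b) ∈ π → b < M := by
    intro a b h
    have := YoungDiagram.mem_iff_lt_rowLen.1 (π.up_left_mem (Nat.zero_le a) le_rfl h)
    omega
  simp only [Finset.mem_product, Finset.mem_range]
  exact ⟨key _ _ h2, key _ _ h1⟩

/-- `GSC_{M,t}(k, q) = ∑_π q^{|π|}`, over the self-conjugate partitions `π` with largest part at
most `M` and GBG-rank mod `t` equal to `k`, as a formal power series in `q`. -/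
noncomputable def GSC (M t : ℕ) (k : ℤ) : PowerSeries ℚ :=
  ∑ π ∈ (scPartitions_finite M t k).toFinset, (PowerSeries.X : PowerSeries ℚ) ^ π.card

/-- The finite `q`-Pochhammer symbol `(a; q)_L = ∏_{j=0}^{L-1} (1 - a q^j)`. -/
noncomputable def qPoch (a q : PowerSeries ℚ) (L : ℕ) : PowerSeries ℚ :=
  ∏ j ∈ Finset.range L, (1 - a * q ^ j)

/-- The Gaussian binomial coefficient `[m choose n]_q`, equal to `(q)_m / ((q)_n (q)_{m-n})` if
`0 ≤ n ≤ m` and to `0` otherwise, where `(q)_L = (q; q)_L`. It is used for `q` with zero constant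
coefficient only; then `(q)_n (q)_{m-n}` has constant coefficient `1`, and `⁻¹` is its true
inverse. -/
noncomputable def gaussBinom (q : PowerSeries ℚ) (m n : ℤ) : PowerSeries ℚ :=
  if 0 ≤ n ∧ n ≤ m then
    qPoch q q m.toNat * (qPoch q q n.toNat * qPoch q q (m - n).toNat)⁻¹
  else 0

end GBGRank

namespace GBGRank

open PowerSeries

/-! A self-conjugate diagram is cut by its diagonal into symmetric hooks, and the set `S` of their
arm lengths determines it: any finite `S` occurs, the size is the sum of `2a + 1` over `S`, and the
largest part is at most `M` exactly when `S ⊆ {0, ..., M - 1}` (`exists_ofHooks_eq`,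
`ofHooks_injective`, `card_ofHooks`).

The hook with arm `a` has contents `-a, ..., a`, so `1 - ω⁻¹` times its contribution to the rank
telescopes to `ω^a - ω^(-a-1)`. Hence arms congruent to `i` and to `t - 1 - i` count with opposite
signs. For prime `t` the only integer relations among `1, ω, ..., ω^(t-1)` have all coefficients
equal, so rank `k` means: the signed count of arms is `k` for the pair `{0, t - 1}` and `0` for
every other pair (`gbgRank_ofHooks_eq_iff`).

These conditions concern disjoint residue classes, so the generating function factors
(`sum_powerset_signed`). The middle class `(t - 1)/2` is its own opposite and unconstrained, which
gives the Pochhammer symbol. Each other pair gives a coefficient of a finite Jacobi triple product,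
a power of `q` times a Gaussian binomial (`signedSum_progression`). -/

/-! ### Gaussian binomials -/

theorem qPoch_succ (a q : PowerSeries ℚ) (n : ℕ) :
    qPoch a q (n + 1) = qPoch a q n * (1 - a * q ^ n) := Finset.prod_range_succ _ _

theorem constantCoeff_qPoch_self {q : PowerSeries ℚ} (hq : constantCoeff q = 0) (n : ℕ) :
    constantCoeff (qPoch q q n) = 1 := by
  simp [qPoch, map_prod, hq]

/-- Division-free form of the definition, from which the Pascal rule is obtained by cancelling
Pochhammer factors. -/
theorem gaussBinom_add_mul {q : PowerSeries ℚ} (hq : constantCoeff q = 0) (j l : ℕ) :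
    gaussBinom q ((j : ℤ) + l) j * (qPoch q q j * qPoch q q l) = qPoch q q (j + l) := by
  have h1 : ((j : ℤ) + l).toNat = j + l := by omega
  rw [gaussBinom, if_pos (by omega), add_sub_cancel_left, h1, Int.toNat_natCast, Int.toNat_natCast,
    mul_assoc, PowerSeries.inv_mul_cancel, mul_one]
  simp [constantCoeff_qPoch_self hq]

theorem qPoch_self_ne_zero {q : PowerSeries ℚ} (hq : constantCoeff q = 0) (n : ℕ) :
    qPoch q q n ≠ 0 := by
  intro h
  simpa [h] using constantCoeff_qPoch_self hq n

theorem gaussBinom_of_neg (q : PowerSeries ℚ) {m n : ℤ} (h : n < 0) : gaussBinom q m n = 0 :=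
  if_neg (by omega)

theorem gaussBinom_of_lt (q : PowerSeries ℚ) {m n : ℤ} (h : m < n) : gaussBinom q m n = 0 :=
  if_neg (by omega)

theorem gaussBinom_zero_right {q : PowerSeries ℚ} (hq : constantCoeff q = 0) (n : ℕ) :
    gaussBinom q n 0 = 1 := by
  have h := gaussBinom_add_mul hq 0 n
  have h0 : qPoch q q 0 = 1 := by simp [qPoch]
  simp only [Nat.cast_zero, zero_add, h0, one_mul] at h
  exact mul_right_cancel₀ (qPoch_self_ne_zero hq n) (h.trans (one_mul _).symm)

theorem gaussBinom_symm (q : PowerSeries ℚ) (m n : ℤ) :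
    gaussBinom q m (m - n) = gaussBinom q m n := by
  by_cases h : 0 ≤ n ∧ n ≤ m
  · rw [gaussBinom, gaussBinom, if_pos h, if_pos (by omega), sub_sub_cancel,
      mul_comm (qPoch q q (m - n).toNat)]
  · rw [gaussBinom, gaussBinom, if_neg h, if_neg (by omega)]

/-- The `q`-Pascal rule `[n+1, k] = [n, k] + q^(n+1-k) [n, k-1]`. -/
theorem gaussBinom_succ {q : PowerSeries ℚ} (hq : constantCoeff q = 0) (n : ℕ) (k : ℤ) :
    gaussBinom q (n + 1) k =
      gaussBinom q n k + q ^ ((n : ℤ) + 1 - k).toNat * gaussBinom q n (k - 1) := by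
  rcases lt_trichotomy k 0 with hk | rfl | hk
  · simp [gaussBinom_of_neg q hk, gaussBinom_of_neg q (show k - 1 < 0 by omega)]
  · have := gaussBinom_zero_right hq (n + 1)
    push_cast at this
    rw [this, gaussBinom_zero_right hq, gaussBinom_of_neg q (by omega), mul_zero, add_zero]
  rcases lt_trichotomy k (n + 1) with hk' | rfl | hk'
  · obtain ⟨j, rfl⟩ : ∃ j : ℕ, k = j + 1 := ⟨(k - 1).toNat, by omega⟩
    obtain ⟨l, rfl⟩ : ∃ l : ℕ, n = j + 1 + l := ⟨n - (j + 1), by omega⟩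
    have h1 := gaussBinom_add_mul hq (j + 1) (l + 1)
    have h2 := gaussBinom_add_mul hq (j + 1) l
    have h3 := gaussBinom_add_mul hq j (l + 1)
    have e : (((j + 1 + l : ℕ) : ℤ) + 1 - (j + 1)).toNat = l + 1 := by omega
    rw [e, add_sub_cancel_right]
    rw [show (j + 1 + (l + 1) : ℕ) = (j + 1 + l) + 1 by ring] at h1
    rw [show (j + (l + 1) : ℕ) = j + 1 + l by ring] at h3
    simp only [qPoch_succ q q j, qPoch_succ q q l, qPoch_succ q q (j + 1 + l)] at h1 h2 h3
    push_cast at h1 h2 h3 ⊢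
    rw [show (j : ℤ) + 1 + (l + 1) = j + 1 + l + 1 by ring] at h1
    rw [show (j : ℤ) + (l + 1) = j + 1 + l by ring] at h3
    have hne : qPoch q q j * (1 - q * q ^ j) * (qPoch q q l * (1 - q * q ^ l)) ≠ 0 := by
      rw [← qPoch_succ, ← qPoch_succ]
      exact mul_ne_zero (qPoch_self_ne_zero hq _) (qPoch_self_ne_zero hq _)
    apply mul_right_cancel₀ hne
    -- With denominators cleared, this is `1 - q^(j+l+2) = (1 - q^(l+1)) + q^(l+1) (1 - q^(j+1))`.
    linear_combination h1 - (1 - q * q ^ l) * h2 - q ^ (l + 1) * (1 - q * q ^ j) * h3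
  · have h1 := gaussBinom_symm q (n + 1) 0
    have h2 := gaussBinom_symm q n 0
    have h3 := gaussBinom_zero_right hq (n + 1)
    push_cast at h3
    simp only [sub_zero] at h1 h2
    rw [h1, gaussBinom_of_lt q (show (n : ℤ) < n + 1 by omega), add_sub_cancel_right, h2, h3,
      gaussBinom_zero_right hq]
    simp
  · simp [gaussBinom_of_lt q hk', gaussBinom_of_lt q (show (n : ℤ) < k by omega),
      gaussBinom_of_lt q (show (n : ℤ) < k - 1 by omega)]

/-- The `q`-Pascal rule `[n+1, k+1] = [n, k] + q^(k+1) [n, k+1]`. -/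
theorem gaussBinom_succ_succ {q : PowerSeries ℚ} (hq : constantCoeff q = 0) (n : ℕ) (k : ℤ) :
    gaussBinom q (n + 1) (k + 1) =
      gaussBinom q n k + q ^ (k + 1).toNat * gaussBinom q n (k + 1) := by
  rw [← gaussBinom_symm, gaussBinom_succ hq, ← gaussBinom_symm q n k,
    ← gaussBinom_symm q n (k + 1), show (n : ℤ) + 1 - (k + 1) = n - k by ring,
    show (n : ℤ) + 1 - (n - k) = k + 1 by ring, show (n : ℤ) - k - 1 = n - (k + 1) by ring]

/-! ### Signed subset sums and the finite Jacobi triple product -/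

/-- The sum of `∏ w` over the subsets of `T` on which `e` adds up to `c`. -/
noncomputable def signedSum (w : ℕ → PowerSeries ℚ) (e : ℕ → ℤ) (T : Finset ℕ) (c : ℤ) :
    PowerSeries ℚ :=
  ∑ S ∈ T.powerset, if ∑ x ∈ S, e x = c then ∏ x ∈ S, w x else 0

theorem signedSum_empty (w : ℕ → PowerSeries ℚ) (e : ℕ → ℤ) (c : ℤ) :
    signedSum w e ∅ c = if c = 0 then 1 else 0 := by
  simp [signedSum, @eq_comm _ 0 c]

theorem signedSum_insert (w : ℕ → PowerSeries ℚ) (e : ℕ → ℤ) {T : Finset ℕ} {x : ℕ}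
    (hx : x ∉ T) (c : ℤ) :
    signedSum w e (insert x T) c = signedSum w e T c + w x * signedSum w e T (c - e x) := by
  rw [signedSum, Finset.sum_powerset_insert hx, signedSum, signedSum, Finset.mul_sum]
  congr 1
  refine Finset.sum_congr rfl fun S hS => ?_
  have hxS : x ∉ S := fun h => hx (Finset.mem_powerset.1 hS h)
  rw [Finset.sum_insert hxS, Finset.prod_insert hxS, mul_ite, mul_zero]
  exact if_congr ⟨fun h => by omega, fun h => by omega⟩ rfl rfl

theorem signedSum_congr {w : ℕ → PowerSeries ℚ} {e e' : ℕ → ℤ} {T : Finset ℕ}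
    (h : ∀ x ∈ T, e x = e' x) (c : ℤ) : signedSum w e T c = signedSum w e' T c := by
  refine Finset.sum_congr rfl fun S hS => ?_
  rw [Finset.sum_congr rfl fun x hx => h x (Finset.mem_powerset.1 hS hx)]

theorem signedSum_zero (w : ℕ → PowerSeries ℚ) (T : Finset ℕ) :
    signedSum w (fun _ => 0) T 0 = ∏ x ∈ T, (1 + w x) := by
  simp [signedSum, Finset.prod_one_add]

/-- The numbers `t m + r` with `m < n`. -/
def progression (t r n : ℕ) : Finset ℕ := (Finset.range n).image fun m => t * m + r

theorem mem_progression {t r n x : ℕ} : x ∈ progression t r n ↔ ∃ m < n, t * m + r = x := by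
  simp [progression]

theorem progression_succ (t r n : ℕ) :
    progression t r (n + 1) = insert (t * n + r) (progression t r n) := by
  simp [progression, Finset.range_add_one, Finset.image_insert]

theorem notMem_progression {t : ℕ} (ht : 0 < t) (r n : ℕ) :
    t * n + r ∉ progression t r n := by
  rw [mem_progression]
  rintro ⟨m, hm, h⟩
  have := Nat.mul_lt_mul_of_pos_left hm ht
  omega

/-- The residue of `x` modulo `t` counted with sign: `1` if it is `i`, `-1` if it is `t - 1 - i`,
`0` if it is both or neither. -/
def residueSign (t i x : ℕ) : ℤ :=
  (if x % t = i then 1 else 0) - (if x % t = t - 1 - i then 1 else 0)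

/-- A finite form of the Jacobi triple product: the coefficient of `z^c` in
`∏ (1 + z q^(2(tm+i)+1)) ∏ (1 + z⁻¹ q^(2(tm+t-1-i)+1))`. -/
theorem signedSum_progression {t i : ℕ} (hi : 2 * i + 1 < t) (a b : ℕ) (c : ℤ) :
    signedSum (fun x => X ^ (2 * x + 1)) (residueSign t i)
      (progression t i a ∪ progression t (t - 1 - i) b) c =
    X ^ ((2 * (i : ℤ) + 1) * c + t * (c * (c - 1))).toNat
      * gaussBinom (X ^ (2 * t)) ((a : ℤ) + b) (b + c) := by
  have hq : constantCoeff ((X : PowerSeries ℚ) ^ (2 * t)) = 0 := by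
    rw [map_pow, constantCoeff_X, zero_pow (by omega)]
  -- No exponent of the triple product is truncated by `toNat`.
  have hE : ∀ c : ℤ, 0 ≤ (2 * (i : ℤ) + 1) * c + t * (c * (c - 1)) := by
    intro c
    have ht : (2 * (i : ℤ) + 1) < t := by exact_mod_cast hi
    rcases le_or_gt c 0 with h | h
    · nlinarith [mul_nonneg (neg_nonneg.2 h) (sub_nonneg.2 ht.le), mul_self_nonneg c]
    · have : 0 ≤ c * (c - 1) := mul_nonneg h.le (by omega)
      positivity
  have hmod : ∀ r < t, ∀ m, (t * m + r) % t = r := fun r hr m => by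
    rw [Nat.mul_add_mod, Nat.mod_eq_of_lt hr]
  induction a generalizing c with
  | zero =>
    induction b generalizing c with
    | zero =>
      simp only [progression, Finset.range_zero, Finset.image_empty, Finset.union_empty,
        signedSum_empty, Nat.cast_zero, zero_add]
      split_ifs with h
      · subst h
        simpa using (gaussBinom_zero_right hq 0).symm
      · rcases lt_or_gt_of_ne h with h | h
        · rw [gaussBinom_of_neg _ h, mul_zero]
        · rw [gaussBinom_of_lt _ h, mul_zero]
    | succ b ih =>
      have h0 : progression t i 0 = ∅ := rfl
      rw [h0, Finset.empty_union] at ih ⊢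
      rw [progression_succ, signedSum_insert _ _ (notMem_progression (by omega) _ _), ih, ih]
      have hs : residueSign t i (t * b + (t - 1 - i)) = -1 := by
        rw [residueSign, hmod _ (by omega), if_neg (by omega), if_pos rfl]; rfl
      rw [hs]
      -- Leaving out or choosing the new element, of sign `-1`, gives the two terms of this Pascal
      -- rule.
      have hp := gaussBinom_succ_succ hq b (b + c)
      push_cast
      simp only [zero_add] at hp ⊢
      rw [show (b : ℤ) + 1 + c = b + c + 1 by ring, hp,
        mul_add (X ^ ((2 * (i : ℤ) + 1) * c + t * (c * (c - 1))).toNat)]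
      congr 1
      rw [sub_neg_eq_add, ← add_assoc, ← mul_assoc (X ^ _ : PowerSeries ℚ) (X ^ _),
        ← mul_assoc (X ^ _ : PowerSeries ℚ) ((X ^ (2 * t)) ^ _)]
      -- The Pascal exponent is truncated only when the binomial beside it vanishes.
      rcases lt_or_ge ((b : ℤ) + c + 1) 0 with h | h
      · rw [gaussBinom_of_neg _ h, mul_zero, mul_zero]
      · rw [← pow_mul, ← pow_add, ← pow_add]
        congr 2
        zify
        rw [Int.toNat_of_nonneg (hE _), Int.toNat_of_nonneg (hE _), Int.toNat_of_nonneg h,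
          Nat.cast_sub (by omega), Nat.cast_sub (by omega)]
        push_cast
        ring
  | succ a ih =>
    rw [progression_succ, Finset.insert_union, signedSum_insert, ih, ih]
    · have hs : residueSign t i (t * a + i) = 1 := by
        rw [residueSign, hmod _ (by omega), if_pos rfl, if_neg (by omega)]; rfl
      rw [hs]
      -- A new element of sign `1` matches the other Pascal rule.
      have hp := gaussBinom_succ hq (a + b) (b + c)
      push_cast at hp ⊢
      rw [show (a : ℤ) + 1 + b = a + b + 1 by ring, hp,
        mul_add (X ^ ((2 * (i : ℤ) + 1) * c + t * (c * (c - 1))).toNat)]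
      congr 1
      rw [← add_sub_assoc, ← mul_assoc (X ^ _ : PowerSeries ℚ) (X ^ _),
        ← mul_assoc (X ^ _ : PowerSeries ℚ) ((X ^ (2 * t)) ^ _)]
      rcases lt_or_ge ((a : ℤ) + b + 1 - (b + c)) 0 with h | h
      · rw [gaussBinom_of_lt _ (show (a : ℤ) + b < b + c - 1 by omega), mul_zero, mul_zero]
      · rw [← pow_mul, ← pow_add, ← pow_add]
        congr 2
        zify
        rw [Int.toNat_of_nonneg (hE _), Int.toNat_of_nonneg (hE _), Int.toNat_of_nonneg h]
        ring
    -- The two residues differ because `2i + 1 < t`.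
    · rw [Finset.mem_union, not_or]
      refine ⟨notMem_progression (by omega) _ _, fun h => ?_⟩
      obtain ⟨m, -, h⟩ := mem_progression.1 h
      have := congrArg (· % t) h
      simp only [hmod _ (show t - 1 - i < t by omega), hmod i (by omega)] at this
      omega

/-! ### Factorisation over residue classes -/

/-- A sum over the subsets of `T` of a product of functions of the parts of the subset in the
classes `cls = i` factors. -/
theorem sum_powerset_prod_filter {ι : Type*} [DecidableEq ι] (I : Finset ι) (T : Finset ℕ)
    (cls : ℕ → ι) (hcls : ∀ x ∈ T, cls x ∈ I) (F : ι → Finset ℕ → PowerSeries ℚ) :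
    ∑ S ∈ T.powerset, ∏ i ∈ I, F i (S.filter fun x => cls x = i) =
      ∏ i ∈ I, ∑ S ∈ (T.filter fun x => cls x = i).powerset, F i S := by
  rw [Finset.prod_sum]
  -- A subset corresponds to the tuple of its parts in the classes; the inverse takes the union.
  refine Finset.sum_bij' (fun S _ i _ => S.filter fun x => cls x = i)
    (fun p _ => I.attach.biUnion fun i => p i.1 i.2) ?_ ?_ ?_ ?_ ?_
  · intro S hS
    rw [Finset.mem_pi]
    intro i hi
    exact Finset.mem_powerset.2 (Finset.filter_subset_filter _ (Finset.mem_powerset.1 hS))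
  · intro p hp
    rw [Finset.mem_powerset, Finset.biUnion_subset]
    intro i _
    exact (Finset.mem_powerset.1 (Finset.mem_pi.1 hp i.1 i.2)).trans (Finset.filter_subset _ _)
  · intro S hS
    ext x
    simp only [Finset.mem_biUnion, Finset.mem_attach, true_and, Subtype.exists, Finset.mem_filter]
    exact ⟨fun ⟨_, _, h, _⟩ => h, fun h => ⟨_, hcls x (Finset.mem_powerset.1 hS h), h, rfl⟩⟩
  · intro p hp
    have hp' : ∀ i (hi : i ∈ I), ∀ x ∈ p i hi, cls x = i := fun i hi x hx =>
      (Finset.mem_filter.1 (Finset.mem_powerset.1 (Finset.mem_pi.1 hp i hi) hx)).2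
    funext i hi
    ext x
    simp only [Finset.mem_biUnion, Finset.mem_attach, true_and, Subtype.exists, Finset.mem_filter]
    constructor
    · rintro ⟨⟨j, hj, hx⟩, h⟩
      have := hp' j hj x hx
      subst this
      subst h
      exact hx
    · exact fun hx => ⟨⟨i, hi, hx⟩, hp' i hi x hx⟩
  · intro S _
    exact (Finset.prod_attach I fun i => F i (S.filter fun x => cls x = i)).symm

/-- Sums over subsets with one sign condition for each class are products over the classes. -/
theorem sum_powerset_signed {ι : Type*} [DecidableEq ι] (I : Finset ι) (T : Finset ℕ)
    (cls : ℕ → ι) (hcls : ∀ x ∈ T, cls x ∈ I) (w : ℕ → PowerSeries ℚ) (e : ι → ℕ → ℤ)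
    (he : ∀ i ∈ I, ∀ x ∈ T, cls x ≠ i → e i x = 0) (c : ι → ℤ) :
    ∑ S ∈ T.powerset, (if ∀ i ∈ I, ∑ x ∈ S, e i x = c i then ∏ x ∈ S, w x else 0) =
      ∏ i ∈ I, signedSum w (e i) (T.filter fun x => cls x = i) (c i) := by
  simp only [signedSum]
  rw [← sum_powerset_prod_filter I T cls hcls
    (fun i S => if ∑ x ∈ S, e i x = c i then ∏ x ∈ S, w x else 0)]
  refine Finset.sum_congr rfl fun S hS => ?_
  have hS' := Finset.mem_powerset.1 hS
  -- Elements outside class `i` have `e i` equal to zero, so the `i`th condition sees only that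
  -- class.
  have hf : ∀ i ∈ I, ∑ x ∈ S.filter (fun x => cls x = i), e i x = ∑ x ∈ S, e i x := by
    intro i hi
    refine Finset.sum_filter_of_ne fun x hx h => ?_
    by_contra hne
    exact h (he i hi x (hS' hx) hne)
  split_ifs with h
  · rw [← Finset.prod_fiberwise_of_maps_to (fun x hx => hcls x (hS' hx))]
    refine Finset.prod_congr rfl fun i hi => ?_
    rw [if_pos ((hf i hi).trans (h i hi))]
  · push Not at h
    obtain ⟨i, hi, h⟩ := h
    refine (Finset.prod_eq_zero hi (if_neg ?_)).symm
    rwa [hf i hi]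

/-- The elements of a residue class modulo `t` below `t N + ν`. -/
theorem progression_eq_filter {t r : ℕ} (hr : r < t) (N ν : ℕ) (hν : ν < t) :
    progression t r (N + if r < ν then 1 else 0) =
      (Finset.range (t * N + ν)).filter fun x => x % t = r := by
  ext x
  rw [mem_progression, Finset.mem_filter, Finset.mem_range]
  have key : ∀ m, m < (N + if r < ν then 1 else 0) ↔ t * m + r < t * N + ν := by
    intro m
    rcases lt_trichotomy m N with h | rfl | h
    · have h1 : t * (m + 1) ≤ t * N := Nat.mul_le_mul_left t h
      rw [mul_add_one] at h1
      exact iff_of_true (by omega) (by omega)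
    · split_ifs <;> omega
    · have h1 : t * (N + 1) ≤ t * m := Nat.mul_le_mul_left t h
      rw [mul_add_one] at h1
      refine iff_of_false ?_ (by omega)
      split_ifs <;> omega
  constructor
  · rintro ⟨m, hm, rfl⟩
    exact ⟨(key m).1 hm, by rw [Nat.mul_add_mod, Nat.mod_eq_of_lt hr]⟩
  · rintro ⟨hx, rfl⟩
    have := Nat.div_add_mod x t
    exact ⟨x / t, (key _).2 (by omega), this⟩

/-! ### Self-conjugate diagrams as sets of diagonal hooks -/

/-- The number of elements of `S` that are at least `c`. -/
def tailCount (S : Finset ℕ) (c : ℕ) : ℕ := (S.filter fun a => c ≤ a).card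

theorem tailCount_eq_succ_add (S : Finset ℕ) (c : ℕ) :
    tailCount S c = tailCount S (c + 1) + if c ∈ S then 1 else 0 := by
  have h : (S.filter fun a => c ≤ a) =
      (S.filter fun a => c + 1 ≤ a) ∪ (S.filter fun a => a = c) := by
    ext a
    simp only [Finset.mem_union, Finset.mem_filter, ← and_or_left]
    exact and_congr_right fun _ => by omega
  rw [tailCount, h, Finset.card_union_of_disjoint, Finset.filter_eq']
  · simp only [tailCount]
    split_ifs <;> simp
  · rw [Finset.disjoint_filter]
    intros
    omega

theorem tailCount_succ_le (S : Finset ℕ) (c : ℕ) : tailCount S (c + 1) ≤ tailCount S c := by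
  rw [tailCount_eq_succ_add S c]
  omega

theorem tailCount_le_succ (S : Finset ℕ) (c : ℕ) : tailCount S c ≤ tailCount S (c + 1) + 1 := by
  rw [tailCount_eq_succ_add S c]
  split_ifs <;> omega

theorem tailCount_eq_zero_iff {S : Finset ℕ} {c : ℕ} : tailCount S c = 0 ↔ ∀ a ∈ S, a < c := by
  simp [tailCount, Finset.filter_eq_empty_iff]

theorem tailCount_pos_le_sup {S : Finset ℕ} {c : ℕ} (h : 0 < tailCount S c) : c ≤ S.sup id := by
  obtain ⟨a, ha⟩ := Finset.card_pos.1 h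
  rw [Finset.mem_filter] at ha
  exact ha.2.trans (Finset.le_sup (f := id) ha.1)

/-- The membership condition for the self-conjugate diagram whose diagonal hooks have the
elements of `S` as arm lengths. -/
def InHooks (S : Finset ℕ) (x : ℕ × ℕ) : Prop :=
  -- The sum of truncated differences is the absolute value of the content. The hooks meeting that
  -- diagonal are those with at least this arm length, each in one cell, and these cells form its
  -- initial segment.
  min x.1 x.2 < tailCount S ((x.2 - x.1) + (x.1 - x.2))

theorem inHooks_swap {S : Finset ℕ} {i j : ℕ} : InHooks S (i, j) ↔ InHooks S (j, i) := by
  rw [InHooks, InHooks, min_comm, add_comm]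

theorem inHooks_of_le {S : Finset ℕ} {i j : ℕ} (h : i ≤ j) :
    InHooks S (i, j) ↔ i < tailCount S (j - i) := by
  rw [InHooks, min_eq_left h]
  simp only [Nat.sub_eq_zero_of_le h, add_zero]

/-- Above the diagonal, a step left lowers the absolute content, so the tail count does not drop.
Below it, the tail count drops by at most one, which the drop in `min` compensates. -/
theorem InHooks.of_succ_right {S : Finset ℕ} {i j : ℕ} (h : InHooks S (i, j + 1)) :
    InHooks S (i, j) := by
  rcases Nat.lt_or_ge j i with hij | hij
  · rw [inHooks_swap, inHooks_of_le (by omega)] at h ⊢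
    have := tailCount_le_succ S (i - (j + 1))
    rw [show i - j = i - (j + 1) + 1 by omega]
    omega
  · rw [inHooks_of_le (by omega)] at h ⊢
    rw [show j + 1 - i = j - i + 1 by omega] at h
    exact h.trans_le (tailCount_succ_le S _)

theorem InHooks.mono_right {S : Finset ℕ} {i j j' : ℕ} (hj : j' ≤ j) (h : InHooks S (i, j)) :
    InHooks S (i, j') := by
  induction hj with
  | refl => exact h
  | step _ ih => exact ih h.of_succ_right

theorem InHooks.mono {S : Finset ℕ} {i j i' j' : ℕ} (hi : i' ≤ i) (hj : j' ≤ j)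
    (h : InHooks S (i, j)) : InHooks S (i', j') :=
  inHooks_swap.1 ((inHooks_swap.1 (h.mono_right hj)).mono_right hi)

theorem InHooks.lt {S : Finset ℕ} {i j : ℕ} (h : InHooks S (i, j)) : j < S.sup id + 1 := by
  have h0 := h.mono (Nat.zero_le i) le_rfl
  rw [inHooks_of_le (Nat.zero_le j), Nat.sub_zero] at h0
  have := tailCount_pos_le_sup h0
  omega

open Classical in
/-- The self-conjugate diagram whose diagonal hooks have the elements of `S` as arm lengths. -/
noncomputable def ofHooks (S : Finset ℕ) : YoungDiagram where
  cells := (Finset.range (S.sup id + 1) ×ˢ Finset.range (S.sup id + 1)).filter (InHooks S)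
  isLowerSet := by
    rintro ⟨i, j⟩ ⟨i', j'⟩ hle h
    simp only [Finset.coe_filter, Finset.mem_product, Finset.mem_range, Set.mem_ofPred_eq] at h ⊢
    have h' := h.2.mono hle.1 hle.2
    exact ⟨⟨(inHooks_swap.1 h').lt, h'.lt⟩, h'⟩

theorem mem_ofHooks {S : Finset ℕ} {i j : ℕ} : (i, j) ∈ ofHooks S ↔ InHooks S (i, j) := by
  classical
  rw [← YoungDiagram.mem_cells, ofHooks]
  simp only [Finset.mem_filter, Finset.mem_product, Finset.mem_range, and_iff_right_iff_imp]
  exact fun h => ⟨(inHooks_swap.1 h).lt, h.lt⟩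

theorem transpose_ofHooks (S : Finset ℕ) : (ofHooks S).transpose = ofHooks S := by
  ext ⟨i, j⟩
  rw [YoungDiagram.mem_cells, YoungDiagram.mem_cells, YoungDiagram.mem_transpose, Prod.swap_prod_mk,
    mem_ofHooks, mem_ofHooks, inHooks_swap]

theorem rowLen_zero_ofHooks_le_iff {S : Finset ℕ} {M : ℕ} :
    (ofHooks S).rowLen 0 ≤ M ↔ S ⊆ Finset.range M := by
  rw [← not_lt, ← YoungDiagram.mem_iff_lt_rowLen, mem_ofHooks, inHooks_of_le (Nat.zero_le M),
    Nat.sub_zero, not_lt, Nat.le_zero, tailCount_eq_zero_iff]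
  simp [Finset.subset_iff]

/-- The diagonal of content `c` has `tailCount S c` cells, and the jumps of this function are the
elements of `S`. -/
theorem ofHooks_injective : Function.Injective ofHooks := by
  intro S S' h
  have hc : ∀ c, tailCount S c = tailCount S' c := by
    intro c
    refine le_antisymm ?_ ?_ <;> refine le_of_forall_lt fun i hi => ?_
    all_goals
      have key : ∀ S : Finset ℕ, i < tailCount S c ↔ (i, i + c) ∈ ofHooks S := fun S => by
        rw [mem_ofHooks, inHooks_of_le (by omega), Nat.add_sub_cancel_left]
      rw [key] at hi ⊢
    · rwa [← h]
    · rwa [h]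
  ext a
  have h1 := tailCount_eq_succ_add S a
  have h2 := tailCount_eq_succ_add S' a
  rw [hc, hc, h2, add_right_inj] at h1
  split_ifs at h1 <;> simp_all

open Classical in
/-- The number of cells `(i, i + c)` of a diagram. -/
noncomputable def diagLen (π : YoungDiagram) (c : ℕ) : ℕ :=
  Nat.find (p := fun i => (i, i + c) ∉ π)
    ⟨π.colLen 0, fun h => by
      have := YoungDiagram.mem_iff_lt_colLen.1 (π.up_left_mem le_rfl (Nat.zero_le _) h)
      omega⟩

theorem lt_diagLen_iff {π : YoungDiagram} {i c : ℕ} : i < diagLen π c ↔ (i, i + c) ∈ π := by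
  rw [diagLen, Nat.lt_find_iff]
  refine ⟨fun h => not_not.1 (h i le_rfl), fun h m hm => not_not.2 ?_⟩
  exact π.up_left_mem hm (by omega) h

theorem diagLen_succ_le (π : YoungDiagram) (c : ℕ) : diagLen π (c + 1) ≤ diagLen π c := by
  refine le_of_forall_lt fun i hi => ?_
  rw [lt_diagLen_iff] at hi ⊢
  exact π.up_left_mem le_rfl (by omega) hi

/-- If `(i + 1, i + 1 + c)` is a cell, so is `(i, i + 1 + c)`, which lies on the next diagonal. -/
theorem diagLen_le_succ (π : YoungDiagram) (c : ℕ) : diagLen π c ≤ diagLen π (c + 1) + 1 := by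
  by_contra! h
  have h1 : (diagLen π (c + 1), diagLen π (c + 1) + (c + 1)) ∈ π :=
    π.up_left_mem (Nat.le_succ _) (by omega) (lt_diagLen_iff.1 h)
  exact lt_irrefl _ (lt_diagLen_iff.2 h1)

theorem diagLen_eq_zero {π : YoungDiagram} {c : ℕ} (h : π.rowLen 0 ≤ c) : diagLen π c = 0 := by
  by_contra h0
  have := YoungDiagram.mem_iff_lt_rowLen.1 (lt_diagLen_iff.1 (Nat.pos_of_ne_zero h0))
  omega

/-- Every self-conjugate diagram is determined by the arm lengths of its diagonal hooks. -/
theorem exists_ofHooks_eq {π : YoungDiagram} (hπ : π.transpose = π) : ∃ S, ofHooks S = π := by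
  classical
  -- The arm lengths are the places where the diagonal length drops.
  let S := (Finset.range (π.rowLen 0)).filter fun a => diagLen π a ≠ diagLen π (a + 1)
  have hbig : ∀ c, π.rowLen 0 ≤ c → tailCount S c = diagLen π c := by
    intro c hc
    rw [diagLen_eq_zero hc, tailCount_eq_zero_iff]
    intro a ha
    have := Finset.mem_range.1 (Finset.mem_filter.1 ha).1
    omega
  -- Descending induction on `c` from the largest part, beyond which both sides vanish; `n` bounds
  -- the distance.
  have hS : ∀ n c, π.rowLen 0 ≤ c + n → tailCount S c = diagLen π c := by
    intro n
    induction n with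
    | zero => exact hbig
    | succ n ih =>
      intro c hc
      rcases le_or_gt (π.rowLen 0) c with h | h
      · exact hbig c h
      have h1 := diagLen_succ_le π c
      have h2 := diagLen_le_succ π c
      rw [tailCount_eq_succ_add, ih (c + 1) (by omega)]
      simp only [S, Finset.mem_filter, Finset.mem_range, h, true_and]
      split_ifs <;> omega
  have hS' : ∀ c, tailCount S c = diagLen π c := fun c => hS (π.rowLen 0) c (by omega)
  have key : ∀ i j, i ≤ j → ((i, j) ∈ ofHooks S ↔ (i, j) ∈ π) := by
    intro i j hij
    rw [mem_ofHooks, inHooks_of_le hij, hS', lt_diagLen_iff, Nat.add_sub_cancel' hij]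
  refine ⟨S, ?_⟩
  ext ⟨i, j⟩
  rw [YoungDiagram.mem_cells, YoungDiagram.mem_cells]
  rcases le_total i j with h | h
  · exact key i j h
  · rw [← hπ, ← transpose_ofHooks, YoungDiagram.mem_transpose, YoungDiagram.mem_transpose]
    exact key j i h

/-! ### Contents of the hooks and the GBG-rank -/

/-- A sum over the cells of a function of the content is a sum over the diagonal hooks. -/
theorem sum_cells_ofHooks (S : Finset ℕ) (g : ℤ → ℂ) :
    ∑ x ∈ (ofHooks S).cells, g ((x.2 : ℤ) - x.1) =
      ∑ a ∈ S, ∑ c ∈ Finset.Icc (-(a : ℤ)) a, g c := by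
  have hI : ∀ a ∈ S, Finset.Icc (-(a : ℤ)) a =
      (Finset.Icc (-((S.sup id : ℕ) : ℤ)) (S.sup id : ℕ)).filter fun c => c.natAbs ≤ a := by
    intro a ha
    have : a ≤ S.sup id := Finset.le_sup (f := id) ha
    ext c
    simp only [Finset.mem_filter, Finset.mem_Icc]
    omega
  have hR : ∑ a ∈ S, ∑ c ∈ Finset.Icc (-(a : ℤ)) a, g c =
      ∑ c ∈ Finset.Icc (-((S.sup id : ℕ) : ℤ)) (S.sup id : ℕ),
        ∑ a ∈ S, if c.natAbs ≤ a then g c else 0 := by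
    rw [Finset.sum_comm]
    exact Finset.sum_congr rfl fun a ha => by rw [hI a ha, Finset.sum_filter]
  rw [hR]
  rw [← Finset.sum_fiberwise_of_maps_to (s := (ofHooks S).cells)
    (t := Finset.Icc (-((S.sup id : ℕ) : ℤ)) (S.sup id : ℕ))
    (g := fun x => (x.2 : ℤ) - x.1)]
  · refine Finset.sum_congr rfl fun c _ => ?_
    have hL : ∑ x ∈ (ofHooks S).cells.filter (fun x => (x.2 : ℤ) - x.1 = c),
        g ((x.2 : ℤ) - x.1) = ∑ x ∈ (ofHooks S).cells.filter (fun x => (x.2 : ℤ) - x.1 = c), g c :=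
      Finset.sum_congr rfl fun x hx => by rw [(Finset.mem_filter.1 hx).2]
    rw [← Finset.sum_filter, Finset.sum_const, hL, Finset.sum_const]
    congr 1
    -- Grouped by content `c`, both sides count the hooks with arm at least `|c|`. Position `m` on
    -- that diagonal is the cell `m` steps along it from the border.
    change _ = tailCount S c.natAbs
    rw [← Finset.card_range (tailCount S c.natAbs)]
    refine Finset.card_bij' (fun x _ => min x.1 x.2)
      (fun m _ => (m + (-c).toNat, m + c.toNat)) ?_ ?_ ?_ ?_
    · rintro ⟨i, j⟩ hx
      rw [Finset.mem_filter, YoungDiagram.mem_cells, mem_ofHooks] at hx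
      rw [Finset.mem_range]
      have h2 := hx.2
      have h1 := hx.1
      simp only [InHooks] at h1 h2 ⊢
      rwa [show c.natAbs = (j - i) + (i - j) by omega]
    · intro m hm
      rw [Finset.mem_range] at hm
      rw [Finset.mem_filter, YoungDiagram.mem_cells, mem_ofHooks]
      refine ⟨?_, by dsimp only; omega⟩
      simp only [InHooks]
      rwa [show min (m + (-c).toNat) (m + c.toNat) = m by omega,
        show (m + c.toNat) - (m + (-c).toNat) + ((m + (-c).toNat) - (m + c.toNat)) = c.natAbs by
          omega]
    · rintro ⟨i, j⟩ hx
      have h2 := (Finset.mem_filter.1 hx).2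
      simp only at h2
      ext <;> simp only <;> omega
    · intro m _
      simp only
      omega
  · rintro ⟨i, j⟩ hx
    rw [YoungDiagram.mem_cells, mem_ofHooks] at hx
    have h1 := hx.lt
    have h2 := (inHooks_swap.1 hx).lt
    rw [Finset.mem_Icc]
    dsimp only
    omega

theorem card_ofHooks (S : Finset ℕ) : (ofHooks S).card = ∑ a ∈ S, (2 * a + 1) := by
  have h := sum_cells_ofHooks S fun _ => 1
  simp only [Finset.sum_const, Int.card_Icc, nsmul_eq_mul, mul_one] at h
  have h' : ((ofHooks S).cells.card : ℂ) = ((∑ a ∈ S, (2 * a + 1) : ℕ) : ℂ) := by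
    rw [h, Nat.cast_sum]
    refine Finset.sum_congr rfl fun a _ => ?_
    congr 1
    omega
  exact_mod_cast h'

theorem gbgRank_eq_sum_zpow (π : YoungDiagram) {t : ℕ} (ht : 0 < t) {ω : ℂ}
    (hω : ω = Complex.exp (2 * (Real.pi : ℂ) * Complex.I / (t : ℂ))) :
    gbgRank π t = ∑ x ∈ π.cells, ω ^ ((x.2 : ℤ) - x.1) := by
  have hprim : IsPrimitiveRoot ω t := hω ▸ Complex.isPrimitiveRoot_exp t ht.ne'
  have ht' : (0 : ℤ) < t := by exact_mod_cast ht
  have hz : ∀ c : ℤ, ω ^ c = ω ^ (c % t).toNat := by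
    intro c
    rw [← zpow_natCast, Int.toNat_of_nonneg (Int.emod_nonneg _ ht'.ne')]
    conv_lhs => rw [← Int.mul_ediv_add_emod c t]
    rw [zpow_add₀ (hprim.ne_zero ht.ne'), zpow_mul, zpow_natCast, hprim.pow_eq_one, one_zpow,
      one_mul]
  rw [gbgRank, ← hω, ← Finset.sum_fiberwise_of_maps_to (s := π.cells) (t := Finset.range t)
    (g := fun x => (((x.2 : ℤ) - x.1) % t).toNat)]
  · refine Finset.sum_congr rfl fun j _ => ?_
    rw [residueCount, ← nsmul_eq_mul, ← Finset.sum_const]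
    refine Finset.sum_congr ?_ fun x hx => ?_
    · refine Finset.filter_congr fun x _ => ?_
      have := Int.emod_nonneg ((x.2 : ℤ) - x.1) ht'.ne'
      omega
    · rw [hz, (Finset.mem_filter.1 hx).2]
  · intro x _
    have h1 := Int.emod_nonneg ((x.2 : ℤ) - x.1) ht'.ne'
    have h2 := Int.emod_lt_of_pos ((x.2 : ℤ) - x.1) ht'
    rw [Finset.mem_range]
    omega

/-- The left side is the telescoping sum of `ω^c - ω^(c-1)`. -/
theorem one_sub_inv_mul_sum_Icc_zpow {ω : ℂ} (hω : ω ≠ 0) (a : ℕ) :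
    (1 - ω⁻¹) * ∑ c ∈ Finset.Icc (-(a : ℤ)) a, ω ^ c = ω ^ (a : ℤ) - ω ^ (-(a : ℤ) - 1) := by
  induction a with
  | zero => simp
  | succ a ih =>
    have h : Finset.Icc (-((a + 1 : ℕ) : ℤ)) (a + 1 : ℕ) =
        insert ((a : ℤ) + 1) (insert (-(a : ℤ) - 1) (Finset.Icc (-(a : ℤ)) a)) := by
      ext c
      simp only [Finset.mem_insert, Finset.mem_Icc]
      omega
    have h1 : ω⁻¹ * ω ^ ((a : ℤ) + 1) = ω ^ (a : ℤ) := by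
      rw [zpow_add_one₀ hω]
      field_simp
    have h2 : ω⁻¹ * ω ^ (-(a : ℤ) - 1) = ω ^ (-(a : ℤ) - 1 - 1) := by
      rw [zpow_sub_one₀ hω (-(a : ℤ) - 1), mul_comm]
    rw [h, Finset.sum_insert, Finset.sum_insert, mul_add, mul_add, ih]
    · push_cast
      rw [show -((a : ℤ) + 1) - 1 = -(a : ℤ) - 1 - 1 by ring]
      linear_combination -h1 - h2
    · simp only [Finset.mem_Icc]
      omega
    · simp only [Finset.mem_insert, Finset.mem_Icc]
      omega

/-- Since `ω^t = 1`, the exponents `a` and `-a - 1` reduce to `a % t` and `t - 1 - a % t`. If these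
coincide, both sides vanish. -/
theorem sum_residueSign_mul_pow {ω : ℂ} {t : ℕ} (ht : 0 < t) (hω : IsPrimitiveRoot ω t) (a : ℕ) :
    ∑ j ∈ Finset.range t, (residueSign t j a : ℂ) * ω ^ j =
      ω ^ (a : ℤ) - ω ^ (-(a : ℤ) - 1) := by
  have hlt := Nat.mod_lt a ht
  have ha := Nat.div_add_mod a t
  have h1 : ω ^ (a : ℤ) = ω ^ (a % t) := by
    rw [zpow_natCast]
    conv_lhs => rw [← ha]
    rw [pow_add, pow_mul, hω.pow_eq_one, one_pow, one_mul]
  have h2 : ω ^ (-(a : ℤ) - 1) = ω ^ (t - 1 - a % t) := by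
    have : -(a : ℤ) - 1 = (t : ℤ) * (-((a / t : ℕ) : ℤ) - 1) + ((t - 1 - a % t : ℕ) : ℤ) := by
      have ha' : (t : ℤ) * ((a / t : ℕ) : ℤ) + ((a % t : ℕ) : ℤ) = a := by exact_mod_cast ha
      rw [Nat.cast_sub (by omega), Nat.cast_sub (by omega)]
      push_cast at ha' ⊢
      linear_combination ha'
    rw [this, zpow_add₀ (hω.ne_zero ht.ne'), zpow_mul, zpow_natCast, hω.pow_eq_one, one_zpow,
      one_mul, zpow_natCast]
  rw [h1, h2]
  have h3 : ∀ j ∈ Finset.range t, (residueSign t j a : ℂ) * ω ^ j =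
      (if a % t = j then ω ^ j else 0) - (if t - 1 - a % t = j then ω ^ j else 0) := by
    intro j hj
    rw [Finset.mem_range] at hj
    rw [residueSign, if_congr (show a % t = t - 1 - j ↔ t - 1 - a % t = j by omega) rfl rfl]
    split_ifs <;> simp
  rw [Finset.sum_congr rfl h3, Finset.sum_sub_distrib, Finset.sum_ite_eq, Finset.sum_ite_eq,
    if_pos (Finset.mem_range.2 hlt), if_pos (Finset.mem_range.2 (by omega))]

/-- For a prime `t` the GBG-rank determines the differences of the numbers of diagonal hooks in
opposite residue classes. -/
theorem gbgRank_ofHooks_eq_iff {t : ℕ} (ht : t.Prime) (S : Finset ℕ) (k : ℤ) :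
    gbgRank (ofHooks S) t = k ↔
      ∀ j < t, ∑ a ∈ S, residueSign t j a =
        (if j = 0 then k else 0) - (if j = t - 1 then k else 0) := by
  set ω : ℂ := Complex.exp (2 * (Real.pi : ℂ) * Complex.I / (t : ℂ)) with hω
  have hprim : IsPrimitiveRoot ω t := Complex.isPrimitiveRoot_exp t ht.ne_zero
  have hω0 : ω ≠ 0 := hprim.ne_zero ht.ne_zero
  have hω1 : 1 - ω⁻¹ ≠ 0 := by
    rw [sub_ne_zero]
    exact fun h => hprim.ne_one ht.one_lt (inv_eq_one.1 h.symm)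
  have hinv : ω⁻¹ = ω ^ (t - 1) := by
    exact inv_eq_of_mul_eq_one_left
      (by rw [← pow_succ, Nat.sub_add_cancel ht.pos, hprim.pow_eq_one])
  -- The coefficients of `1 - ω⁻¹` times the difference of the rank and `k`, where `ω⁻¹ = ω^(t-1)`.
  let y : ℕ → ℤ := fun j =>
    ∑ a ∈ S, residueSign t j a - ((if j = 0 then k else 0) - (if j = t - 1 then k else 0))
  have hrank : (1 - ω⁻¹) * gbgRank (ofHooks S) t =
      ∑ j ∈ Finset.range t, ((∑ a ∈ S, residueSign t j a : ℤ) : ℂ) * ω ^ j := by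
    rw [gbgRank_eq_sum_zpow _ ht.pos hω, sum_cells_ofHooks S fun c => ω ^ c, Finset.mul_sum]
    simp only [one_sub_inv_mul_sum_Icc_zpow hω0, ← sum_residueSign_mul_pow ht.pos hprim]
    rw [Finset.sum_comm]
    simp [Finset.sum_mul]
  have hk : (1 - ω⁻¹) * (k : ℂ) = ∑ j ∈ Finset.range t,
      (((if j = 0 then k else 0) - (if j = t - 1 then k else 0) : ℤ) : ℂ) * ω ^ j := by
    simp only [Int.cast_sub, Int.cast_ite, Int.cast_zero, sub_mul, ite_mul, zero_mul,
      Finset.sum_sub_distrib, Finset.sum_ite_eq']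
    rw [if_pos (Finset.mem_range.2 ht.pos), if_pos (Finset.mem_range.2 (by have := ht.pos; omega)),
      hinv]
    ring
  have hy : gbgRank (ofHooks S) t = k ↔ ∑ j : Fin t, (y j : ℂ) * ω ^ (j : ℕ) = 0 := by
    rw [← mul_right_inj' hω1, hrank, hk, ← sub_eq_zero, ← Finset.sum_sub_distrib,
      Finset.sum_range]
    simp only [y, Int.cast_sub, sub_mul]
  rw [hy, hprim.sum_eq_zero_iff_forall_eq_int ht fun j => y j]
  -- Primality only makes all `y j` equal; since they also add up to zero, each is zero.
  have hsum : ∑ j ∈ Finset.range t, y j = 0 := by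
    have h1 : ∀ a ∈ S, ∑ j ∈ Finset.range t, residueSign t j a = 0 := by
      intro a _
      have hlt := Nat.mod_lt a ht.pos
      have h3 : ∀ j ∈ Finset.range t, residueSign t j a =
          (if a % t = j then 1 else 0) - (if t - 1 - a % t = j then 1 else 0) := by
        intro j hj
        rw [Finset.mem_range] at hj
        rw [residueSign, if_congr (show a % t = t - 1 - j ↔ t - 1 - a % t = j by omega) rfl rfl]
      rw [Finset.sum_congr rfl h3, Finset.sum_sub_distrib, Finset.sum_ite_eq, Finset.sum_ite_eq,
        if_pos (Finset.mem_range.2 hlt), if_pos (Finset.mem_range.2 (by omega)), sub_self]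
    simp only [y, Finset.sum_sub_distrib, Finset.sum_ite_eq']
    rw [Finset.sum_comm, Finset.sum_eq_zero h1, if_pos (Finset.mem_range.2 ht.pos),
      if_pos (Finset.mem_range.2 (by have := ht.pos; omega)), sub_self, sub_self]
  constructor
  · intro h j hj
    have h1 : ∀ i ∈ Finset.range t, y i = y j := fun i hi =>
      h ⟨i, Finset.mem_range.1 hi⟩ ⟨j, hj⟩
    rw [Finset.sum_congr rfl h1, Finset.sum_const, Finset.card_range, smul_eq_zero] at hsum
    exact sub_eq_zero.1 (hsum.resolve_left ht.ne_zero)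
  · intro h i j
    have h0 : ∀ j : Fin t, y j = 0 := fun j => sub_eq_zero.2 (h j j.2)
    simp only [h0]

theorem residueSign_reflect {t j : ℕ} (hj : j < t) (a : ℕ) :
    residueSign t (t - 1 - j) a = -residueSign t j a := by
  rw [residueSign, residueSign, show t - 1 - (t - 1 - j) = j by omega, neg_sub]

/-- Conditions `j` and `t - 1 - j` are negatives of each other, so half of them suffice. The middle
one is vacuous and is kept so that the indices match the classes `min (x % t) (t - 1 - x % t)`. -/
theorem gbgRank_ofHooks_eq_iff_of_odd {t : ℕ} (ht : t.Prime) (hodd : Odd t) (S : Finset ℕ)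
    (k : ℤ) :
    gbgRank (ofHooks S) t = k ↔
      ∀ i ∈ Finset.range ((t + 1) / 2), ∑ a ∈ S, residueSign t i a = if i = 0 then k else 0 := by
  have h2 := ht.two_le
  obtain ⟨m, rfl⟩ := hodd
  rw [gbgRank_ofHooks_eq_iff ht]
  constructor
  · intro h i hi
    rw [Finset.mem_range] at hi
    rw [h i (by omega), if_neg (show i ≠ 2 * m + 1 - 1 by omega), sub_zero]
  · intro h j hj
    rcases Nat.lt_or_ge j ((2 * m + 1 + 1) / 2) with hj' | hj'
    · rw [h j (Finset.mem_range.2 hj'), if_neg (show j ≠ 2 * m + 1 - 1 by omega), sub_zero]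
    · obtain ⟨i, hi, rfl⟩ : ∃ i < m, j = 2 * m + 1 - 1 - i := ⟨2 * m - j, by omega, by omega⟩
      simp only [residueSign_reflect (show i < 2 * m + 1 by omega), Finset.sum_neg_distrib]
      rw [h i (Finset.mem_range.2 (by omega)), if_neg (show 2 * m + 1 - 1 - i ≠ 0 by omega),
        zero_sub]
      exact congrArg _ (if_congr (by omega) rfl rfl)

/-! ### The generating function as a product over classes -/

theorem GSC_eq_sum_powerset {t : ℕ} (ht : t.Prime) (hodd : Odd t) (M : ℕ) (k : ℤ) :
    GSC M t k = ∑ S ∈ (Finset.range M).powerset,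
      (if ∀ i ∈ Finset.range ((t + 1) / 2), ∑ x ∈ S, residueSign t i x = if i = 0 then k else 0
        then ∏ x ∈ S, (X : PowerSeries ℚ) ^ (2 * x + 1) else 0) := by
  rw [← Finset.sum_filter, GSC]
  symm
  refine Finset.sum_bij (fun S _ => ofHooks S) ?_ (fun _ _ _ _ h => ofHooks_injective h) ?_ ?_
  · intro S hS
    rw [Finset.mem_filter, Finset.mem_powerset] at hS
    rw [Set.Finite.mem_toFinset]
    exact ⟨transpose_ofHooks S, (gbgRank_ofHooks_eq_iff_of_odd ht hodd S k).2 hS.2,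
      rowLen_zero_ofHooks_le_iff.2 hS.1⟩
  · intro π hπ
    rw [Set.Finite.mem_toFinset] at hπ
    obtain ⟨hsc, hk, hM⟩ := hπ
    obtain ⟨S, rfl⟩ := exists_ofHooks_eq hsc
    refine ⟨S, ?_, rfl⟩
    rw [Finset.mem_filter, Finset.mem_powerset]
    exact ⟨rowLen_zero_ofHooks_le_iff.1 hM, (gbgRank_ofHooks_eq_iff_of_odd ht hodd S k).1 hk⟩
  · intro S _
    rw [card_ofHooks, Finset.prod_pow_eq_pow_sum]

/-- This ceiling, like the floor below, records whether a residue class has an extra element below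
`t N + ν`. -/
theorem ceil_div_eq_ite {t : ℕ} {x : ℚ} (h1 : -(t : ℚ) < x) (h2 : x ≤ t) :
    ⌈x / t⌉ = if 0 < x then 1 else 0 := by
  have ht : (0 : ℚ) < t := by linarith
  split_ifs with h
  · rw [Int.ceil_eq_iff]
    refine ⟨?_, ?_⟩
    · simpa using div_pos h ht
    · simpa using (div_le_one ht).2 h2
  · rw [Int.ceil_eq_iff]
    refine ⟨?_, ?_⟩
    · rw [lt_div_iff₀ ht]
      push_cast
      linarith
    · rw [Int.cast_zero]
      exact div_nonpos_of_nonpos_of_nonneg (not_lt.1 h) ht.le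

theorem floor_div_eq_ite {t : ℕ} {x : ℚ} (h1 : 0 ≤ x) (h2 : x < 2 * t) :
    ⌊x / t⌋ = if (t : ℚ) ≤ x then 1 else 0 := by
  have ht : (0 : ℚ) < t := by linarith
  split_ifs with h
  · rw [Int.floor_eq_iff, le_div_iff₀ ht, div_lt_iff₀ ht]
    push_cast
    constructor <;> linarith
  · rw [Int.floor_eq_iff, le_div_iff₀ ht, div_lt_iff₀ ht]
    push_cast
    constructor <;> linarith

/-- The sum over the subsets of a pair of opposite residue classes. -/
theorem signedSum_filter {t i : ℕ} (hi : 2 * i + 1 < t) (N ν : ℕ) (hν : ν < t) (c : ℤ) :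
    signedSum (fun x => X ^ (2 * x + 1)) (residueSign t i)
      ((Finset.range (t * N + ν)).filter fun x => min (x % t) (t - 1 - x % t) = i) c =
    X ^ ((2 * (i : ℤ) + 1) * c + t * (c * (c - 1))).toNat
      * gaussBinom (X ^ (2 * t))
          (2 * (N : ℤ) + ⌈((ν : ℚ) - (i : ℚ)) / (t : ℚ)⌉ + ⌊((ν : ℚ) + (i : ℚ)) / (t : ℚ)⌋)
          ((N : ℤ) + ⌊((ν : ℚ) + (i : ℚ)) / (t : ℚ)⌋ + c) := by
  have hset : ((Finset.range (t * N + ν)).filter fun x => min (x % t) (t - 1 - x % t) = i) =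
      progression t i (N + if i < ν then 1 else 0) ∪
        progression t (t - 1 - i) (N + if t - 1 - i < ν then 1 else 0) := by
    rw [progression_eq_filter (by omega) N ν hν, progression_eq_filter (by omega) N ν hν,
      ← Finset.filter_or]
    refine Finset.filter_congr fun x _ => ?_
    have := Nat.mod_lt x (show 0 < t by omega)
    omega
  have hν' : (ν : ℚ) < t := by exact_mod_cast hν
  have hi' : (i : ℚ) < t := by exact_mod_cast (show i < t by omega)
  have hν0 : (0 : ℚ) ≤ ν := Nat.cast_nonneg _
  have hi0 : (0 : ℚ) ≤ i := Nat.cast_nonneg _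
  have hceil : ⌈((ν : ℚ) - (i : ℚ)) / (t : ℚ)⌉ = ((if i < ν then 1 else 0 : ℕ) : ℤ) := by
    rw [ceil_div_eq_ite (by linarith) (by linarith), Nat.cast_ite]
    exact if_congr (by rw [sub_pos, Nat.cast_lt]) rfl rfl
  -- The class `t - 1 - i` has its extra element when `t - 1 - i < ν`, that is, `t ≤ ν + i`.
  have hfloor : ⌊((ν : ℚ) + (i : ℚ)) / (t : ℚ)⌋ =
      ((if t - 1 - i < ν then 1 else 0 : ℕ) : ℤ) := by
    rw [floor_div_eq_ite (by linarith) (by linarith), Nat.cast_ite]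
    refine if_congr ?_ rfl rfl
    rw [← Nat.cast_add, Nat.cast_le]
    omega
  rw [hset, signedSum_progression hi, hceil, hfloor]
  push_cast
  ring_nf

/-- The sum over the subsets of the middle residue class. -/
theorem signedSum_filter_middle (m N ν : ℕ) (hν : ν < 2 * m + 1) :
    signedSum (fun x => X ^ (2 * x + 1)) (residueSign (2 * m + 1) m)
      ((Finset.range ((2 * m + 1) * N + ν)).filter fun x =>
        min (x % (2 * m + 1)) (2 * m + 1 - 1 - x % (2 * m + 1)) = m) 0 =
    qPoch (-(X ^ (2 * m + 1))) (X ^ (2 * (2 * m + 1))) (N + if m < ν then 1 else 0) := by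
  have hset : ((Finset.range ((2 * m + 1) * N + ν)).filter fun x =>
      min (x % (2 * m + 1)) (2 * m + 1 - 1 - x % (2 * m + 1)) = m) =
      progression (2 * m + 1) m (N + if m < ν then 1 else 0) := by
    rw [progression_eq_filter (by omega) N ν hν]
    refine Finset.filter_congr fun x _ => ?_
    have := Nat.mod_lt x (show 0 < 2 * m + 1 by omega)
    omega
  -- The middle residue is its own opposite, so the signs cancel and every subset is allowed.
  have he : ∀ x ∈ progression (2 * m + 1) m (N + if m < ν then 1 else 0),
      residueSign (2 * m + 1) m x = 0 := by
    intro x _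
    rw [residueSign, show 2 * m + 1 - 1 - m = m by omega, sub_self]
  rw [hset, signedSum_congr he, signedSum_zero, progression, Finset.prod_image, qPoch]
  · refine Finset.prod_congr rfl fun j _ => ?_
    rw [neg_mul, sub_neg_eq_add, ← pow_mul, ← pow_add]
    congr 2
    ring
  · intro a _ b _ h
    exact Nat.eq_of_mul_eq_mul_left (Nat.succ_pos (2 * m)) (Nat.add_right_cancel h)

end GBGRank

open PowerSeries in
/-- Every integer to which `Int.toNat` is applied here is non-negative. -/
theorem theorem2p3 (t : ℕ) (ht : t.Prime) (hodd : Odd t) (N ν : ℕ) (hν : ν ≤ t - 1) (k : ℤ) :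
    GBGRank.GSC (t * N + ν) t k =
      (X : PowerSeries ℚ) ^ ((t : ℤ) * k ^ 2 - ((t : ℤ) - 1) * k).toNat
      * GBGRank.qPoch (-(X ^ t)) (X ^ (2 * t))
          ((N : ℤ) + ⌈((ν : ℚ) - ((t : ℚ) - 1) / 2) / (t : ℚ)⌉).toNat
      * GBGRank.gaussBinom (X ^ (2 * t)) (2 * (N : ℤ) + ⌈(ν : ℚ) / (t : ℚ)⌉) ((N : ℤ) + k)
      * ∏ i ∈ Finset.Icc 1 ((t - 3) / 2),
          GBGRank.gaussBinom (X ^ (2 * t))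
            (2 * (N : ℤ) + ⌈((ν : ℚ) - (i : ℚ)) / (t : ℚ)⌉ + ⌊((ν : ℚ) + (i : ℚ)) / (t : ℚ)⌋)
            ((N : ℤ) + ⌊((ν : ℚ) + (i : ℚ)) / (t : ℚ)⌋) := by
  have h2 := ht.two_le
  have hνt : ν < t := by omega
  rw [GBGRank.GSC_eq_sum_powerset ht hodd, GBGRank.sum_powerset_signed _ _
    (fun x => min (x % t) (t - 1 - x % t)) (fun x _ => ?_) _ _ (fun i hi x _ hx => ?_)]
  · obtain ⟨m, rfl⟩ : ∃ m, t = 2 * (m + 1) + 1 := by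
      obtain ⟨m, rfl⟩ := hodd
      exact ⟨m - 1, by omega⟩
    have hν' : (ν : ℚ) < (2 * (m + 1) + 1 : ℕ) := by exact_mod_cast hνt
    have hν0 : (0 : ℚ) ≤ ν := Nat.cast_nonneg _
    have hL : ((N : ℤ) + ⌈((ν : ℚ) - (((2 * (m + 1) + 1 : ℕ) : ℚ) - 1) / 2)
        / ((2 * (m + 1) + 1 : ℕ) : ℚ)⌉).toNat = N + if m + 1 < ν then 1 else 0 := by
      have hm0 : (0 : ℚ) ≤ m := Nat.cast_nonneg _
      rw [GBGRank.ceil_div_eq_ite (by push_cast; linarith) (by push_cast at hν' ⊢; linarith)]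
      have hiff : 0 < (ν : ℚ) - (((2 * (m + 1) + 1 : ℕ) : ℚ) - 1) / 2 ↔ m + 1 < ν := by
        rw [← Nat.cast_lt (α := ℚ), ← sub_pos (b := ((m + 1 : ℕ) : ℚ))]
        push_cast
        ring_nf
      rw [if_congr hiff rfl rfl]
      split_ifs <;> omega
    have hfloor : ⌊(ν : ℚ) / ((2 * (m + 1) + 1 : ℕ) : ℚ)⌋ = 0 := by
      rw [GBGRank.floor_div_eq_ite hν0 (by linarith), if_neg (by linarith)]
    -- The classes `0, ..., m + 1` are split into the pair `0`, which carries `k`, the pairs `1,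
    -- ..., m`, and the middle class `m + 1`.
    rw [show (2 * (m + 1) + 1 + 1) / 2 = m + 1 + 1 by omega,
      show (2 * (m + 1) + 1 - 3) / 2 = m by omega, Finset.prod_range_succ, Finset.prod_range_succ',
      hL, if_neg (Nat.succ_ne_zero m), GBGRank.signedSum_filter_middle (m + 1) N ν hνt, if_pos rfl,
      GBGRank.signedSum_filter (by omega) N ν hνt]
    simp only [Nat.cast_zero, sub_zero, add_zero, mul_zero, zero_add, one_mul, hfloor]
    have hprod : ∏ i ∈ Finset.range m, GBGRank.signedSum (fun x => X ^ (2 * x + 1))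
        (GBGRank.residueSign (2 * (m + 1) + 1) (i + 1))
        ((Finset.range ((2 * (m + 1) + 1) * N + ν)).filter fun x =>
          min (x % (2 * (m + 1) + 1)) (2 * (m + 1) + 1 - 1 - x % (2 * (m + 1) + 1)) = i + 1)
        (if i + 1 = 0 then k else 0) =
        ∏ i ∈ Finset.Icc 1 m, GBGRank.gaussBinom (X ^ (2 * (2 * (m + 1) + 1)))
            (2 * (N : ℤ) + ⌈((ν : ℚ) - (i : ℚ)) / ((2 * (m + 1) + 1 : ℕ) : ℚ)⌉
              + ⌊((ν : ℚ) + (i : ℚ)) / ((2 * (m + 1) + 1 : ℕ) : ℚ)⌋)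
            ((N : ℤ) + ⌊((ν : ℚ) + (i : ℚ)) / ((2 * (m + 1) + 1 : ℕ) : ℚ)⌋) := by
      rw [← Finset.Ico_add_one_right_eq_Icc, Finset.prod_Ico_eq_prod_range,
        show m + 1 - 1 = m from rfl]
      refine Finset.prod_congr rfl fun i hi => ?_
      rw [Finset.mem_range] at hi
      rw [if_neg (Nat.succ_ne_zero i), GBGRank.signedSum_filter (by omega) N ν hνt, add_comm 1 i]
      simp
    rw [hprod, show ((2 * (m + 1) + 1 : ℕ) : ℤ) * k ^ 2 - (((2 * (m + 1) + 1 : ℕ) : ℤ) - 1) * k =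
      k + ((2 * (m + 1) + 1 : ℕ) : ℤ) * (k * (k - 1)) by ring]
    ring
  · have := Nat.mod_lt x ht.pos
    obtain ⟨m, rfl⟩ := hodd
    rw [Finset.mem_range]
    omega
  -- As `i` is at most `(t - 1)/2`, either residue `i` or `t - 1 - i` puts `x` in class `i`.
  · have := Nat.mod_lt x ht.pos
    rw [Finset.mem_range] at hi
    rw [GBGRank.residueSign]
    split_ifs <;> omega
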